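/- Let $H$ be a finite-dimensional real Hilbert space, $m\ge 1$, $G_1,\dots,G_m$ real Hilbert spaces, and $B_i:H\to G_i$ bounded linear operators. For a Hilbert space $E$ let $\Gamma_0(E)$ be the set of proper lower semicontinuous convex functions $E\to(-\infty,+\infty]$; for $\varphi\in\Gamma_0(E)$ and $t>0$ let $\varphi^*(y)=\sup_{x}\{\langle x,y\rangle-\varphi(x)\}$ and $\operatorname{prox}_{t\varphi}(v)=\operatorname{argmin}_{x}\{\tfrac12\|x-v\|^2+t\varphi(x)\}$. Let $f:H\to\mathbb R$ be convex and differentiable with $L$-Lipschitz gradient, $L>0$, let $g\in\Gamma_0(H)$ and $h_i\in\Gamma_0(G_i)$, put $F(x)=g(x)+\sum_{i=1}^m h_i(B_ix)$, and assume that the problem $$\min_{x\in H}\; f(x)+g(x)+\sum_{i=1}^m h_i(B_ix)\qquad(1.1)$$ has a solution (a minimizer at which the objective is finite). Let $\gamma\in(0,2/L)$ and $\lambda>0$ with $\lambda\sum_{i=1}^m\|B_i\|^2<2$. For any $x^0\in H$ and $y^0\in G_1\times\dots\times G_m$, consider the nested dual forward-backward algorithm: for $k=0,1,2,\dots$ put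 $$u^k=x^k-\gamma\nabla f(x^k),$$ run the inner loop, for $j=0,1,2,\dots$ and $i=1,\dots,m$, $$y_i^{k,j+1}=\operatorname{prox}_{\frac{\lambda}{\gamma}h_i^*}\Big(y_i^{k,j}+\tfrac{\lambda}{\gamma}B_i\,p^{k,j}\Big),\qquad p^{k,j}=\operatorname{prox}_{\gamma g}\Big(u^k-\gamma\sum_{l=1}^m B_l^*y_l^{k,j}\Big),$$ where $y^{0,0}=y^0$ and the later starting vectors $y^{k,0}$, $k\ge1$, are arbitrary (for instance the last dual vector of the preceding inner loop, or $y^0$), and obtain $x^{k+1}$ from the inner loop. Then: 1. Every inner loop converges: $\operatorname{prox}_{\gamma F}(u^k)$ exists and $p^{k,j}\to\operatorname{prox}_{\gamma F}(u^k)$ as $j\to\infty$. (In particular, every stopping criterion that asks for a given positive accuracy is reached after finitely many inner steps.) 2. If the inner loops are carried to convergence, that is, $x^{k+1}=\lim_{j\to\infty}p^{k,j}$ for all $k$, then $(x^k)$ converges to a solution of (1.1). 3. If the $k$-th inner loop is stopped after $J_k+1$ steps, $x^{k+1}=p^{k,J_k+1}$, by a stopping criterion that makes the errors summable, $\sum_{k}\|x^{k+1}-\operatorname{prox}_{\gamma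 F}(u^k)\|<\infty$, then $(x^k)$ converges to a solution of (1.1). -/

import Mathlib

open Filter Topology
open scoped NNReal

/-- `φ ∈ Γ₀(E)`: `φ : E → (-∞, +∞]` is proper, lower semicontinuous and convex
(convexity is convexity of the epigraph in `E × ℝ`). -/
structure IsGammaZero {E : Type*} [NormedAddCommGroup E] [InnerProductSpace ℝ E]
    (φ : E → EReal) : Prop where
  ne_bot : ∀ x, φ x ≠ ⊥
  exists_ne_top : ∃ x, φ x ≠ ⊤
  lsc : LowerSemicontinuous φ
  convex : Convex ℝ {p : E × ℝ | φ p.1 ≤ (p.2 : EReal)}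

/-- The Fenchel conjugate `φ*(y) = sup_x (⟨x, y⟩ - φ x)`. -/
noncomputable def fenchelConj {E : Type*} [NormedAddCommGroup E] [InnerProductSpace ℝ E]
    (φ : E → EReal) (y : E) : EReal :=
  ⨆ x : E, ((inner ℝ x y : ℝ) : EReal) - φ x

/-- `p` minimizes `x ↦ ‖x - v‖² / 2 + t φ(x)`. -/
def IsProx {E : Type*} [NormedAddCommGroup E] [InnerProductSpace ℝ E]
    (t : ℝ) (φ : E → EReal) (v p : E) : Prop :=
  ∀ x : E, ((‖p - v‖ ^ 2 / 2 : ℝ) : EReal) + (t : EReal) * φ p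
    ≤ ((‖x - v‖ ^ 2 / 2 : ℝ) : EReal) + (t : EReal) * φ x

/-- The proximity operator `prox_{tφ}(v) = argmin_x {‖x - v‖² / 2 + t φ(x)}`; for `φ ∈ Γ₀(E)`,
`E` a Hilbert space and `t > 0` the minimizer exists and is unique. -/
noncomputable def prox {E : Type*} [NormedAddCommGroup E] [InnerProductSpace ℝ E]
    (t : ℝ) (φ : E → EReal) (v : E) : E :=
  Classical.epsilon (IsProx t φ v)

/-- The nonsmooth part `g(x) + ∑ i, h_i(B_i x)` of the objective. -/
noncomputable def nonsmoothPart {H : Type*} [NormedAddCommGroup H] [InnerProductSpace ℝ H]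
    {m : ℕ} {G : Fin m → Type*} [∀ i, NormedAddCommGroup (G i)] [∀ i, InnerProductSpace ℝ (G i)]
    (g : H → EReal) (h : ∀ i, G i → EReal) (B : ∀ i, H →L[ℝ] G i) (x : H) : EReal :=
  g x + ∑ i, h i (B i x)

/-- `x` solves `min f(x) + g(x) + ∑ i, h_i(B_i x)`: the objective is finite at `x`, and `x` is a
global minimizer. -/
def IsSolution {H : Type*} [NormedAddCommGroup H] [InnerProductSpace ℝ H]
    {m : ℕ} {G : Fin m → Type*} [∀ i, NormedAddCommGroup (G i)] [∀ i, InnerProductSpace ℝ (G i)]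
    (f : H → ℝ) (g : H → EReal) (h : ∀ i, G i → EReal) (B : ∀ i, H →L[ℝ] G i) (x : H) : Prop :=
  (f x : EReal) + nonsmoothPart g h B x ≠ ⊤ ∧
    ∀ z : H, (f x : EReal) + nonsmoothPart g h B x ≤ (f z : EReal) + nonsmoothPart g h B z

/-- The primal point `prox_{γg}(u - γ ∑ i, B_i^* y_i)` attached to the dual vector `y`. -/
noncomputable def primalPoint {H : Type*} [NormedAddCommGroup H] [InnerProductSpace ℝ H]
    [CompleteSpace H] {m : ℕ} {G : Fin m → Type*} [∀ i, NormedAddCommGroup (G i)]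
    [∀ i, InnerProductSpace ℝ (G i)] [∀ i, CompleteSpace (G i)]
    (g : H → EReal) (B : ∀ i, H →L[ℝ] G i) (γ : ℝ) (u : H) (y : ∀ i, G i) : H :=
  prox γ g (u - γ • ∑ i, ContinuousLinearMap.adjoint (B i) (y i))

/-- The outer (forward) steps and the inner loops of the nested dual forward-backward algorithm,
started at `x₀` and `y₀`. Here `y k j` is the `j`-th dual iterate of the inner loop of the `k`-th
outer step. The starting vectors `y k 0` of the later inner loops are left free, so that
both warm starts and restarts at `y₀` are instances. How `x (k + 1)` is obtained from the `k`-th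
inner loop is not part of this structure. -/
structure IsNestedDualFB {H : Type*} [NormedAddCommGroup H] [InnerProductSpace ℝ H]
    [CompleteSpace H] {m : ℕ} {G : Fin m → Type*} [∀ i, NormedAddCommGroup (G i)]
    [∀ i, InnerProductSpace ℝ (G i)] [∀ i, CompleteSpace (G i)]
    (f : H → ℝ) (g : H → EReal) (h : ∀ i, G i → EReal) (B : ∀ i, H →L[ℝ] G i)
    (γ lam : ℝ) (x₀ : H) (y₀ : ∀ i, G i)
    (x u : ℕ → H) (y : ℕ → ℕ → ∀ i, G i) : Prop where
  init_x : x 0 = x₀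
  init_y : y 0 0 = y₀
  outer : ∀ k, u k = x k - γ • gradient f (x k)
  inner_step : ∀ k j i, y k (j + 1) i =
    prox (lam / γ) (fenchelConj (h i))
      (y k j i + (lam / γ) • B i (primalPoint g B γ (u k) (y k j)))

/-! Two forward-backward arguments are nested. The outer map `T = prox_{γF} ∘ (id - γ∇f)` has the
solutions as its fixed points. Cocoercivity of `∇f` (`ConvexOn.norm_gradient_sub_sq_le`) and firm
nonexpansiveness of the proximity operator make it nonexpansive, and strictly so from a non-fixed
point towards any fixed point. In finite dimension this gives convergence under summable errors
(`exists_tendsto_fixedPoint_of_summable_error`).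

The inner loop is forward-backward splitting with step `λ/γ²` on the dual of `min ‖x - u‖²/2 +
γF(x)`; the smooth part of this dual has a gradient with Lipschitz constant at most `γ²∑‖B_i‖²`.
Without a qualification condition, dual minimizers need not exist, so only dual values are followed.
They descend to the dual infimum (`dualObjective_step_le`, `eventually_lt_of_descent`), which is
minus the primal value (`exists_dualObjective_le`), and strong convexity bounds the squared distance
from the primal point to the proximal point by twice the gap (`norm_sub_primalPoint_sq_le`). Absence
of a gap only needs lower semicontinuity at `0` of the value function of the perturbed problems,
which the quadratic term provides through compactness in `H`. -/

/-! ### Convex functions with Lipschitz gradient. -/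

section Smooth

variable {H : Type*} [NormedAddCommGroup H] [InnerProductSpace ℝ H] [CompleteSpace H] {f : H → ℝ}

lemma hasDerivAt_comp_line_gradient (hf : Differentiable ℝ f) (x d : H) (t : ℝ) :
    HasDerivAt (fun s : ℝ => f (x + s • d)) (inner ℝ (gradient f (x + t • d)) d) t := by
  have h1 : HasDerivAt (fun s : ℝ => x + s • d) d t := by
    simpa using ((hasDerivAt_id t).smul_const d).const_add x
  have h2 := (hf (x + t • d)).hasFDerivAt.comp_hasDerivAt t h1
  rwa [inner_gradient_left]

lemma ConvexOn.add_inner_gradient_le (hc : ConvexOn ℝ Set.univ f) (hf : Differentiable ℝ f)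
    (x z : H) : f x + inner ℝ (gradient f x) (z - x) ≤ f z := by
  have hd := hasDerivAt_comp_line_gradient hf x (z - x) 0
  have hc' : ConvexOn ℝ Set.univ (fun s : ℝ => f (x + s • (z - x))) := by
    have := hc.comp_affineMap (AffineMap.lineMap x z : ℝ →ᵃ[ℝ] H)
    simpa [Function.comp_def, AffineMap.lineMap_apply, add_comm] using this
  have := hc'.le_slope_of_hasDerivAt (Set.mem_univ 0) (Set.mem_univ 1) one_pos hd
  simp only [slope_def_field, zero_smul, add_zero, one_smul, add_sub_cancel, sub_zero,
    div_one] at this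
  linarith

lemma LipschitzWith.le_add_inner_gradient_add_sq {L : ℝ≥0} (hf : Differentiable ℝ f)
    (hL : LipschitzWith L (gradient f)) (x y : H) :
    f y ≤ f x + inner ℝ (gradient f x) (y - x) + L / 2 * ‖y - x‖ ^ 2 := by
  set d := y - x with hd
  have hder : ∀ t : ℝ, HasDerivAt
      (fun s : ℝ => f (x + s • d) - s * inner ℝ (gradient f x) d - L / 2 * ‖d‖ ^ 2 * s ^ 2)
      (inner ℝ (gradient f (x + t • d)) d - inner ℝ (gradient f x) d - L * ‖d‖ ^ 2 * t) t := by
    intro t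
    have h1 := ((hasDerivAt_comp_line_gradient hf x d t).sub
      ((hasDerivAt_id t).mul_const (inner ℝ (gradient f x) d))).sub
      (((hasDerivAt_id t).pow 2).const_mul (L / 2 * ‖d‖ ^ 2))
    refine h1.congr_deriv ?_
    simp
    ring
  have hanti : AntitoneOn
      (fun s : ℝ => f (x + s • d) - s * inner ℝ (gradient f x) d - L / 2 * ‖d‖ ^ 2 * s ^ 2)
      (Set.Icc 0 1) := by
    refine antitoneOn_of_deriv_nonpos (convex_Icc 0 1)
      (fun t _ => (hder t).continuousAt.continuousWithinAt)
      (fun t _ => (hder t).differentiableAt.differentiableWithinAt) ?_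
    intro t ht
    rw [interior_Icc] at ht
    rw [(hder t).deriv, ← inner_sub_left]
    have h1 := real_inner_le_norm (gradient f (x + t • d) - gradient f x) d
    have h2 := hL.norm_sub_le (x + t • d) x
    rw [add_sub_cancel_left, norm_smul, Real.norm_of_nonneg ht.1.le] at h2
    nlinarith [mul_le_mul_of_nonneg_right h2 (norm_nonneg d)]
  have := hanti (Set.left_mem_Icc.2 zero_le_one) (Set.right_mem_Icc.2 zero_le_one) zero_le_one
  simp only [one_smul, zero_smul, add_zero, hd, add_sub_cancel] at this
  simp only [hd]
  linarith

/-- The value of `f` at the gradient-type step `y - d / L`, with `d` the gradient difference, is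
bounded below by the tangent at `x` and above by the quadratic model at `y`. -/
lemma ConvexOn.add_inner_gradient_add_sq_le {L : ℝ≥0} (hL0 : 0 < L)
    (hc : ConvexOn ℝ Set.univ f) (hf : Differentiable ℝ f) (hL : LipschitzWith L (gradient f))
    (x y : H) :
    f x + inner ℝ (gradient f x) (y - x) + 1 / (2 * L) * ‖gradient f y - gradient f x‖ ^ 2
      ≤ f y := by
  have hLr : (0 : ℝ) < L := hL0
  set d := gradient f y - gradient f x with hd
  have h1 := hc.add_inner_gradient_le hf x (y - (1 / (L : ℝ)) • d)
  have h2 := hL.le_add_inner_gradient_add_sq hf y (y - (1 / (L : ℝ)) • d)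
  have e1 : y - (1 / (L : ℝ)) • d - x = (y - x) - (1 / (L : ℝ)) • d := by abel
  have e2 : y - (1 / (L : ℝ)) • d - y = -((1 / (L : ℝ)) • d) := by abel
  have e3 : ‖d‖ ^ 2 = inner ℝ (gradient f y) d - inner ℝ (gradient f x) d := by
    rw [← inner_sub_left, ← hd, real_inner_self_eq_norm_sq]
  rw [e1, inner_sub_right, inner_smul_right] at h1
  rw [e2, inner_neg_right, inner_smul_right, norm_neg, norm_smul, Real.norm_of_nonneg (by positivity)]
    at h2
  have e4 : (L : ℝ) / 2 * (1 / L * ‖d‖) ^ 2 = 1 / (2 * L) * ‖d‖ ^ 2 := by field_simp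
  have e5 : 1 / (L : ℝ) * inner ℝ (gradient f y) d - 1 / L * inner ℝ (gradient f x) d
      = 1 / (2 * L) * ‖d‖ ^ 2 + 1 / (2 * L) * ‖d‖ ^ 2 := by
    rw [← mul_sub, ← e3]; field_simp; ring
  linarith

/-- The Baillon-Haddad theorem: the gradient is cocoercive. -/
lemma ConvexOn.norm_gradient_sub_sq_le {L : ℝ≥0} (hL0 : 0 < L)
    (hc : ConvexOn ℝ Set.univ f) (hf : Differentiable ℝ f) (hL : LipschitzWith L (gradient f))
    (x y : H) :
    1 / L * ‖gradient f x - gradient f y‖ ^ 2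
      ≤ inner ℝ (gradient f x - gradient f y) (x - y) := by
  have h1 := hc.add_inner_gradient_add_sq_le hL0 hf hL x y
  have h2 := hc.add_inner_gradient_add_sq_le hL0 hf hL y x
  rw [norm_sub_rev] at h1
  have e : inner ℝ (gradient f x) (y - x) = - inner ℝ (gradient f x) (x - y) := by
    rw [← inner_neg_right, neg_sub]
  rw [inner_sub_left]
  have e2 : 1 / (L : ℝ) * ‖gradient f x - gradient f y‖ ^ 2
    = 1 / (2 * L) * ‖gradient f x - gradient f y‖ ^ 2
      + 1 / (2 * L) * ‖gradient f x - gradient f y‖ ^ 2 := by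
    have : (L : ℝ) ≠ 0 := by exact_mod_cast hL0.ne'
    field_simp; ring
  linarith

/-- The gradient term is retained because its vanishing identifies the equality case in
`norm_forwardBackward_sub_lt`. -/
lemma norm_gradient_step_sub_sq_le {L : ℝ≥0} (hL0 : 0 < L)
    (hc : ConvexOn ℝ Set.univ f) (hf : Differentiable ℝ f) (hL : LipschitzWith L (gradient f))
    {γ : ℝ} (hγ : 0 < γ) (x y : H) :
    ‖(x - γ • gradient f x) - (y - γ • gradient f y)‖ ^ 2
      ≤ ‖x - y‖ ^ 2 - γ * (2 / L - γ) * ‖gradient f x - gradient f y‖ ^ 2 := by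
  have h := hc.norm_gradient_sub_sq_le hL0 hf hL x y
  have e : (x - γ • gradient f x) - (y - γ • gradient f y)
      = (x - y) - γ • (gradient f x - gradient f y) := by
    rw [smul_sub]; abel
  rw [e, norm_sub_sq_real, inner_smul_right, norm_smul, Real.norm_of_nonneg hγ.le,
    real_inner_comm]
  have e2 : γ * (2 / L - γ) * ‖gradient f x - gradient f y‖ ^ 2
    = 2 * γ * (1 / L * ‖gradient f x - gradient f y‖ ^ 2)
      - γ ^ 2 * ‖gradient f x - gradient f y‖ ^ 2 := by ring
  rw [e2]
  nlinarith [mul_le_mul_of_nonneg_left h (by positivity : 0 ≤ 2 * γ)]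

end Smooth

/-! ### Inexact fixed-point iterations. -/

section Iteration

/-- A nonnegative sequence that increases by at most summable amounts converges. -/
lemma exists_tendsto_of_le_add_summable {a e : ℕ → ℝ} (ha : ∀ k, 0 ≤ a k) (he : Summable e)
    (h : ∀ k, a (k + 1) ≤ a k + e k) : ∃ l, Tendsto a atTop (𝓝 l) := by
  have hanti : Antitone (fun k => a k - ∑ i ∈ Finset.range k, e i) := by
    refine antitone_nat_of_succ_le fun k => ?_
    rw [Finset.sum_range_succ]
    linarith [h k]
  have hs := he.hasSum.tendsto_sum_nat
  obtain ⟨b, hb⟩ := hs.bddAbove_range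
  have hbd : BddBelow (Set.range fun k => a k - ∑ i ∈ Finset.range k, e i) := by
    refine ⟨-b, ?_⟩
    rintro _ ⟨k, rfl⟩
    have := hb ⟨k, rfl⟩
    simp only at this ⊢
    linarith [ha k]
  have h1 := (tendsto_atTop_ciInf hanti hbd).add hs
  exact ⟨_, by simpa using h1⟩

/-- Inexact iterates, with summable errors, of a nonexpansive map that moves every other point
strictly closer to each of its fixed points converge to a fixed point. -/
lemma exists_tendsto_fixedPoint_of_summable_error {H : Type*} [NormedAddCommGroup H]
    [ProperSpace H] {T : H → H} (hT : LipschitzWith 1 T)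
    (hstrict : ∀ z x, T z = z → T x ≠ x → ‖T x - z‖ < ‖x - z‖) (hfix : ∃ z, T z = z)
    {x : ℕ → H} (he : Summable fun k => ‖x (k + 1) - T (x k)‖) :
    ∃ z, T z = z ∧ Tendsto x atTop (𝓝 z) := by
  have hle : ∀ z, T z = z → ∀ y, ‖T y - z‖ ≤ ‖y - z‖ := fun z hz y => by
    simpa [hz] using hT.norm_sub_le y z
  have hstep : ∀ z k, ‖x (k + 1) - z‖ ≤ ‖T (x k) - z‖ + ‖x (k + 1) - T (x k)‖ := fun z k => by
    have := norm_add_le (T (x k) - z) (x (k + 1) - T (x k))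
    rwa [show T (x k) - z + (x (k + 1) - T (x k)) = x (k + 1) - z by abel] at this
  have hconv : ∀ z, T z = z → ∃ l, Tendsto (fun k => ‖x k - z‖) atTop (𝓝 l) := fun z hz =>
    exists_tendsto_of_le_add_summable (fun _ => norm_nonneg _) he fun k =>
      (hstep z k).trans (by linarith [hle z hz (x k)])
  obtain ⟨z, hz⟩ := hfix
  obtain ⟨l, hl⟩ := hconv z hz
  -- Squeezed between the distances of `x (k + 1)`, up to the error, and of `x k`.
  have hl' : Tendsto (fun k => ‖T (x k) - z‖) atTop (𝓝 l) := by
    refine tendsto_of_tendsto_of_tendsto_of_le_of_le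
      (g := fun k => ‖x (k + 1) - z‖ - ‖x (k + 1) - T (x k)‖) ?_ hl ?_ (fun k => hle z hz (x k))
    · simpa using (hl.comp (tendsto_add_atTop_nat 1)).sub he.tendsto_atTop_zero
    · intro k
      linarith [hstep z k]
  obtain ⟨R, hR⟩ := hl.bddAbove_range
  obtain ⟨w, -, φ, hφ, hw⟩ := tendsto_subseq_of_bounded (Metric.isBounded_closedBall (x := z) (r := R))
    (x := x) (fun k => by
      rw [mem_closedBall_iff_norm]
      exact hR ⟨k, rfl⟩)
  -- A cluster point and its image are both at distance `l` from `z`, which strictness forbids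
  -- unless the point is fixed.
  have hTw : T w = w := by
    by_contra hne
    have h1 : ‖w - z‖ = l :=
      tendsto_nhds_unique (hw.sub_const z).norm (hl.comp hφ.tendsto_atTop)
    have h2 : ‖T w - z‖ = l :=
      tendsto_nhds_unique (((hT.continuous.tendsto w).comp hw).sub_const z).norm
        (hl'.comp hφ.tendsto_atTop)
    exact absurd (hstrict z w hz hne) (by rw [h1, h2]; exact lt_irrefl l)
  refine ⟨w, hTw, ?_⟩
  obtain ⟨l', hl'⟩ := hconv w hTw
  have h0 : Tendsto (fun k => ‖x (φ k) - w‖) atTop (𝓝 0) := by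
    simpa using (hw.sub_const w).norm
  have : l' = 0 := tendsto_nhds_unique (hl'.comp hφ.tendsto_atTop) h0
  rw [this] at hl'
  exact tendsto_iff_norm_sub_tendsto_zero.2 hl'

end Iteration

/-! ### Extended-real sums, semicontinuity and separation. -/

namespace EReal

lemma coe_finsetSum {ι : Type*} (s : Finset ι) (f : ι → ℝ) :
    ((∑ i ∈ s, f i : ℝ) : EReal) = ∑ i ∈ s, (f i : EReal) := by
  classical
  induction s using Finset.induction_on with
  | empty => simp
  | insert a s ha ih => rw [Finset.sum_insert ha, Finset.sum_insert ha, EReal.coe_add, ih]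

lemma finsetSum_ne_bot {ι : Type*} (s : Finset ι) {f : ι → EReal} (hf : ∀ i, f i ≠ ⊥) :
    ∑ i ∈ s, f i ≠ ⊥ := by
  classical
  induction s using Finset.induction_on with
  | empty => simp
  | insert a s ha ih =>
    rw [Finset.sum_insert ha]
    exact EReal.add_ne_bot_iff.2 ⟨hf a, ih⟩

/-- Replaces an extended-valued inequality by real ones; finiteness of each term is forced because
no term is `⊥`. -/
lemma add_finsetSum_le_coe_iff {ι : Type*} [Fintype ι] {a : EReal} {b : ι → EReal} (ha : a ≠ ⊥)
    (hb : ∀ i, b i ≠ ⊥) {r : ℝ} :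
    a + ∑ i, b i ≤ (r : EReal) ↔
      ∃ (s : ℝ) (t : ι → ℝ), a ≤ s ∧ (∀ i, b i ≤ t i) ∧ s + ∑ i, t i ≤ r := by
  classical
  constructor
  · intro h
    have hne : a + ∑ i, b i ≠ ⊤ := fun h' => by simp [h'] at h
    have hsb := finsetSum_ne_bot Finset.univ hb
    have hat : a ≠ ⊤ := fun h' => hne (by rw [h', EReal.top_add_of_ne_bot hsb])
    have hbt : ∀ i, b i ≠ ⊤ := fun i h' => hne (by
      rw [← Finset.add_sum_erase _ _ (Finset.mem_univ i), h',
        EReal.top_add_of_ne_bot (finsetSum_ne_bot _ hb), EReal.add_top_of_ne_bot ha])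
    refine ⟨a.toReal, fun i => (b i).toReal, (EReal.coe_toReal hat ha).ge,
      fun i => (EReal.coe_toReal (hbt i) (hb i)).ge, ?_⟩
    rw [← EReal.coe_le_coe_iff, EReal.coe_add, coe_finsetSum, EReal.coe_toReal hat ha]
    simpa only [EReal.coe_toReal (hbt _) (hb _)] using h
  · rintro ⟨s, t, hs, ht, hr⟩
    calc a + ∑ i, b i ≤ s + ∑ i, (t i : EReal) :=
          add_le_add hs (Finset.sum_le_sum fun i _ => ht i)
      _ = ((s + ∑ i, t i : ℝ) : EReal) := by rw [EReal.coe_add, coe_finsetSum]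
      _ ≤ r := EReal.coe_le_coe_iff.2 hr

lemma exists_coe_eq_of_le_coe {a : EReal} (ha : a ≠ ⊥) {r : ℝ} (h : a ≤ r) :
    ∃ s : ℝ, a = s ∧ s ≤ r := by
  have hat : a ≠ ⊤ := fun h' => by simp [h'] at h
  refine ⟨a.toReal, (EReal.coe_toReal hat ha).symm, ?_⟩
  rw [← EReal.coe_le_coe_iff, EReal.coe_toReal hat ha]
  exact h

end EReal

lemma lowerSemicontinuous_finsetSum_ereal {X ι : Type*} [TopologicalSpace X] (s : Finset ι)
    {f : ι → X → EReal} (hf : ∀ i, LowerSemicontinuous (f i)) (hb : ∀ i x, f i x ≠ ⊥) :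
    LowerSemicontinuous (fun x => ∑ i ∈ s, f i x) := by
  classical
  induction s using Finset.induction_on with
  | empty => simpa using lowerSemicontinuous_const
  | insert a s ha ih =>
    simp only [Finset.sum_insert ha]
    exact (hf a).add' ih fun x => EReal.continuousAt_add
      (.inr (EReal.finsetSum_ne_bot s fun i => hb i x)) (.inl (hb a x))

/-- A point below a convex, upward closed set, and outside its closure, is separated from it by the
graph of an affine function. -/
lemma exists_affine_minorant_of_notMem_closure {E : Type*} [NormedAddCommGroup E]
    [NormedSpace ℝ E] {C : Set (E × ℝ)} (hC : Convex ℝ C)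
    (hup : ∀ x r r', (x, r) ∈ C → r ≤ r' → (x, r') ∈ C) {x₀ : E} {r₀ r₁ : ℝ}
    (h₁ : (x₀, r₁) ∈ C) (h₀ : (x₀, r₀) ∉ closure C) :
    ∃ l : StrongDual ℝ E, ∀ x r, (x, r) ∈ C → r₀ + l (x - x₀) ≤ r := by
  obtain ⟨F, c, hc, hF⟩ := geometric_hahn_banach_point_closed hC.closure isClosed_closure h₀
  have hdec : ∀ x r, F (x, r) = F (x, 0) + r * F (0, 1) := fun x r => by
    rw [show (x, r) = (x, (0 : ℝ)) + r • ((0 : E), (1 : ℝ)) by simp, map_add, map_smul, smul_eq_mul]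
  -- The hyperplane is not vertical: `C` contains a point over `x₀` at height at least `r₀`, where
  -- `F` is strictly larger.
  have hs : 0 < F (0, 1) := by
    have h2 := hF _ (subset_closure (hup x₀ r₁ (max r₁ r₀) h₁ (le_max_left _ _)))
    rw [hdec] at h2 hc
    by_contra hneg
    nlinarith [le_max_right r₁ r₀]
  refine ⟨-((F (0, 1))⁻¹ • F.comp (ContinuousLinearMap.inl ℝ E ℝ)), fun x r hx => ?_⟩
  have h3 := hc.trans (hF _ (subset_closure hx))
  rw [hdec, hdec x] at h3
  have e : F (x - x₀, 0) = F (x, 0) - F (x₀, 0) := by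
    rw [← map_sub]; simp
  simp only [neg_apply, smul_apply,
    ContinuousLinearMap.comp_apply, ContinuousLinearMap.inl_apply, smul_eq_mul, e]
  have h4 : ∀ a, (F (0, 1))⁻¹ * (a * F (0, 1)) = a := fun a => by field_simp
  have h5 := mul_lt_mul_of_pos_left h3 (inv_pos.2 hs)
  rw [mul_add, mul_add, h4, h4] at h5
  rw [mul_sub]
  linarith

/-- Serves first-order optimality conditions: comparison with a point at parameter `θ` on a segment
leaves, after division by `θ`, a remainder linear in `θ`. -/
lemma nonneg_of_forall_add_mul_nonneg {a b : ℝ} (h : ∀ θ : ℝ, 0 < θ → θ ≤ 1 → 0 ≤ a + θ * b) :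
    0 ≤ a := by
  have ht : Tendsto (fun θ : ℝ => a + θ * b) (𝓝[>] 0) (𝓝 (a + 0 * b)) :=
    ((continuous_const.add (continuous_id.mul continuous_const)).tendsto 0).mono_left
      nhdsWithin_le_nhds
  rw [zero_mul, add_zero] at ht
  refine ge_of_tendsto ht ?_
  filter_upwards [Ioc_mem_nhdsGT (zero_lt_one' ℝ)] with θ hθ
  exact h θ hθ.1 hθ.2

lemma norm_sub_sq_eq_add_add_inner {E : Type*} [NormedAddCommGroup E] [InnerProductSpace ℝ E]
    (x p v : E) :
    ‖x - v‖ ^ 2 = ‖p - v‖ ^ 2 + ‖x - p‖ ^ 2 - 2 * inner ℝ (v - p) (x - p) := by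
  rw [show x - v = (x - p) - (v - p) by abel, norm_sub_sq_real, real_inner_comm,
    norm_sub_rev v p]
  ring

/-! ### Proximity operators and conjugates. -/

namespace IsGammaZero

variable {E : Type*} [NormedAddCommGroup E] [InnerProductSpace ℝ E] {φ : E → EReal}

lemma isClosed_epigraph (hφ : IsGammaZero φ) :
    IsClosed {p : E × ℝ | φ p.1 ≤ (p.2 : EReal)} :=
  hφ.lsc.isClosed_epigraph.preimage
    (continuous_fst.prodMk (continuous_coe_real_ereal.comp continuous_snd))

lemma exists_coe (hφ : IsGammaZero φ) : ∃ (x : E) (r : ℝ), φ x = r := by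
  obtain ⟨x, hx⟩ := hφ.exists_ne_top
  exact ⟨x, (φ x).toReal, (EReal.coe_toReal hx (hφ.ne_bot x)).symm⟩

lemma combo (hφ : IsGammaZero φ) {x y : E} {r s θ : ℝ} (hx : φ x ≤ r) (hy : φ y ≤ s)
    (h0 : 0 ≤ θ) (h1 : θ ≤ 1) :
    φ (x + θ • (y - x)) ≤ ((r + θ * (s - r) : ℝ) : EReal) := by
  have := hφ.convex.add_smul_sub_mem (x := (x, r)) (y := (y, s)) hx hy ⟨h0, h1⟩
  simpa using this

lemma exists_affine_minorant [CompleteSpace E] (hφ : IsGammaZero φ) :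
    ∃ (a : E) (b : ℝ), ∀ x (r : ℝ), φ x ≤ r → inner ℝ a x - b ≤ r := by
  obtain ⟨x₀, r₁, h₁⟩ := hφ.exists_coe
  obtain ⟨l, hl⟩ := exists_affine_minorant_of_notMem_closure hφ.convex
    (fun x r r' hx hr => le_trans hx (EReal.coe_le_coe_iff.2 hr)) (x₀ := x₀) (r₀ := r₁ - 1)
    (r₁ := r₁) h₁.le (by
      rw [hφ.isClosed_epigraph.closure_eq]
      simp only [Set.mem_ofPred_eq, h₁, EReal.coe_le_coe_iff]
      linarith)
  refine ⟨(InnerProductSpace.toDual ℝ E).symm l, l x₀ - (r₁ - 1), fun x r hx => ?_⟩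
  have := hl x r hx
  rw [InnerProductSpace.toDual_symm_apply]
  rw [map_sub] at this
  linarith

/-- Existence of the proximal point, with its characterization by a variational inequality. -/
lemma exists_variational [CompleteSpace E] (hφ : IsGammaZero φ) {t : ℝ} (ht : 0 < t) (v : E) :
    ∃ (p : E) (s : ℝ), φ p = s ∧
      ∀ x (r : ℝ), φ x ≤ r → inner ℝ (v - p) (x - p) ≤ t * (r - s) := by
  set C : Set (E × ℝ) := {p : E × ℝ | φ p.1 ≤ (p.2 : EReal)} with hC
  set J : E × ℝ → ℝ := fun q => ‖q.1 - v‖ ^ 2 / 2 + t * q.2 with hJ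
  obtain ⟨a, b, hab⟩ := hφ.exists_affine_minorant
  have hbdd : BddBelow (J '' C) := by
    -- The minimum of `‖x - v‖² / 2 + t (⟨a, x⟩ - b)`, by completing the square.
    refine ⟨t * inner ℝ a v - t ^ 2 * ‖a‖ ^ 2 / 2 - t * b, ?_⟩
    rintro _ ⟨⟨x, r⟩, hx, rfl⟩
    have h1 := mul_le_mul_of_nonneg_left (hab x r hx) ht.le
    have h2 : 0 ≤ ‖(x - v) + t • a‖ ^ 2 := sq_nonneg _
    rw [norm_add_sq_real, inner_smul_right, norm_smul, Real.norm_of_nonneg ht.le, inner_sub_left,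
      real_inner_comm, real_inner_comm a v] at h2
    simp only [hJ]
    nlinarith
  obtain ⟨x₁, r₁, hx₁⟩ := hφ.exists_coe
  have hne : (J '' C).Nonempty := ⟨_, (x₁, r₁), hx₁.le, rfl⟩
  set μ := sInf (J '' C) with hμ
  have hge : ∀ q ∈ C, μ ≤ J q := fun q hq => csInf_le hbdd ⟨q, hq, rfl⟩
  have hseq : ∀ n : ℕ, ∃ q ∈ C, J q < μ + 1 / ((n : ℝ) + 1) := fun n => by
    obtain ⟨_, ⟨q, hq, rfl⟩, hlt⟩ := exists_lt_of_csInf_lt hne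
      (lt_add_of_pos_right μ (Nat.one_div_pos_of_nat (n := n) (α := ℝ)))
    exact ⟨q, hq, hlt⟩
  choose q hqC hqJ using hseq
  -- Midpoints of epigraph points stay in the epigraph, so the parallelogram law makes minimizing
  -- sequences Cauchy without any compactness.
  have hpar : ∀ n k, ‖(q n).1 - (q k).1‖ ^ 2 ≤ 4 * (1 / ((n : ℝ) + 1) + 1 / ((k : ℝ) + 1)) := by
    intro n k
    have hmid := hφ.combo (hqC n) (hqC k) (by norm_num : (0 : ℝ) ≤ 1 / 2) (by norm_num)
    have h1 := hge (_, _) hmid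
    simp only [hJ] at h1
    have h2 := hqJ n
    have h3 := hqJ k
    simp only [hJ] at h2 h3
    have h4 := parallelogram_law_with_norm ℝ ((q n).1 - v) ((q k).1 - v)
    rw [sub_sub_sub_cancel_right] at h4
    have h5 : ‖(q n).1 - v + ((q k).1 - v)‖
        = 2 * ‖(q n).1 + (1 / 2 : ℝ) • ((q k).1 - (q n).1) - v‖ := by
      rw [show (q n).1 - v + ((q k).1 - v)
        = (2 : ℝ) • ((q n).1 + (1 / 2 : ℝ) • ((q k).1 - (q n).1) - v) by module, norm_smul,
        Real.norm_two]
    rw [h5] at h4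
    nlinarith
  have hcau : CauchySeq (fun n => (q n).1) := by
    refine Metric.cauchySeq_iff'.2 fun ε hε => ?_
    obtain ⟨N, hN⟩ := exists_nat_one_div_lt (by positivity : 0 < ε ^ 2 / 8)
    refine ⟨N, fun n hn => ?_⟩
    rw [dist_eq_norm]
    refine lt_of_pow_lt_pow_left₀ 2 hε.le ?_
    have h1 := hpar n N
    have h2 : 1 / ((n : ℝ) + 1) ≤ 1 / ((N : ℝ) + 1) := Nat.one_div_le_one_div hn
    linarith
  obtain ⟨p, hp⟩ := cauchySeq_tendsto_of_complete hcau
  have hJlim : Tendsto (fun n => J (q n)) atTop (𝓝 μ) := by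
    refine tendsto_of_tendsto_of_tendsto_of_le_of_le tendsto_const_nhds
      (h := fun n : ℕ => μ + 1 / ((n : ℝ) + 1)) ?_ (fun n => hge _ (hqC n)) (fun n => (hqJ n).le)
    simpa using tendsto_one_div_add_atTop_nhds_zero_nat.const_add μ
  have hs : Tendsto (fun n => (q n).2) atTop (𝓝 ((μ - ‖p - v‖ ^ 2 / 2) / t)) := by
    have := (hJlim.sub (((hp.sub_const v).norm.pow 2).div_const 2)).div_const t
    refine this.congr fun n => ?_
    simp only [hJ]
    field_simp
    ring
  have hmem : (p, (μ - ‖p - v‖ ^ 2 / 2) / t) ∈ C :=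
    hφ.isClosed_epigraph.mem_of_tendsto (hp.prodMk_nhds hs) (Eventually.of_forall hqC)
  obtain ⟨s, hps, hs'⟩ := EReal.exists_coe_eq_of_le_coe (hφ.ne_bot p) hmem
  have hJs : J (p, s) ≤ μ := by
    simp only [hJ]
    rw [le_div_iff₀ ht] at hs'
    linarith
  refine ⟨p, s, hps, fun x r hx => ?_⟩
  have hkey : 0 ≤ (t * (r - s) - inner ℝ (v - p) (x - p)) := by
    refine nonneg_of_forall_add_mul_nonneg (b := ‖x - p‖ ^ 2 / 2) fun θ h0 h1 => ?_
    have h2 := hJs.trans (hge (_, _) (hφ.combo hps.le hx h0.le h1))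
    simp only [hJ] at h2
    rw [norm_sub_sq_eq_add_add_inner (p + θ • (x - p)) p v, add_sub_cancel_left, norm_smul,
      inner_smul_right, Real.norm_of_nonneg h0.le] at h2
    have h3 : 0 ≤ θ * (t * (r - s) - inner ℝ (v - p) (x - p) + θ * (‖x - p‖ ^ 2 / 2)) := by
      nlinarith
    exact nonneg_of_mul_nonneg_right h3 h0
  linarith

lemma isProx_of_variational (hφ : IsGammaZero φ) {t : ℝ} (ht : 0 < t) {v p : E} {s : ℝ}
    (hps : φ p = s) (h : ∀ x (r : ℝ), φ x ≤ r → inner ℝ (v - p) (x - p) ≤ t * (r - s)) :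
    IsProx t φ v p := by
  intro x
  by_cases hx : φ x = ⊤
  · rw [hx, EReal.coe_mul_top_of_pos ht, EReal.coe_add_top]
    exact le_top
  · obtain ⟨r, hr⟩ : ∃ r : ℝ, φ x = r := ⟨_, (EReal.coe_toReal hx (hφ.ne_bot x)).symm⟩
    rw [hps, hr]
    norm_cast
    have := h x r hr.le
    rw [norm_sub_sq_eq_add_add_inner x p v]
    nlinarith [sq_nonneg ‖x - p‖]

/-- Strong convexity gives uniqueness, which is what identifies the point chosen by
`Classical.epsilon` in `prox`. -/
lemma eq_of_isProx_of_variational (hφ : IsGammaZero φ) {t : ℝ} (ht : 0 < t) {v p q : E} {s : ℝ}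
    (hps : φ p = s) (h : ∀ x (r : ℝ), φ x ≤ r → inner ℝ (v - p) (x - p) ≤ t * (r - s))
    (hq : IsProx t φ v q) : q = p := by
  have h1 := hq p
  have hqt : φ q ≠ ⊤ := fun h' => by
    rw [h', hps, EReal.coe_mul_top_of_pos ht, EReal.coe_add_top, top_le_iff] at h1
    exact EReal.coe_ne_top _ (by exact_mod_cast h1)
  obtain ⟨r, hr⟩ : ∃ r : ℝ, φ q = r := ⟨_, (EReal.coe_toReal hqt (hφ.ne_bot q)).symm⟩
  rw [hps, hr] at h1
  norm_cast at h1
  have h2 := h q r hr.le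
  rw [norm_sub_sq_eq_add_add_inner q p v] at h1
  have h3 : ‖q - p‖ ^ 2 ≤ 0 := by nlinarith
  exact sub_eq_zero.1 (norm_eq_zero.1 (pow_eq_zero_iff two_ne_zero |>.1
    (le_antisymm h3 (sq_nonneg _))))

lemma isProx_prox [CompleteSpace E] (hφ : IsGammaZero φ) {t : ℝ} (ht : 0 < t) (v : E) :
    IsProx t φ v (prox t φ v) := by
  obtain ⟨p, s, hps, h⟩ := hφ.exists_variational ht v
  exact Classical.epsilon_spec (p := IsProx t φ v) ⟨p, hφ.isProx_of_variational ht hps h⟩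

lemma prox_eq_of_variational [CompleteSpace E] (hφ : IsGammaZero φ) {t : ℝ} (ht : 0 < t) {v p : E}
    {s : ℝ} (hps : φ p = s)
    (h : ∀ x (r : ℝ), φ x ≤ r → inner ℝ (v - p) (x - p) ≤ t * (r - s)) :
    prox t φ v = p :=
  hφ.eq_of_isProx_of_variational ht hps h (hφ.isProx_prox ht v)

lemma prox_spec [CompleteSpace E] (hφ : IsGammaZero φ) {t : ℝ} (ht : 0 < t) (v : E) :
    ∃ s : ℝ, φ (prox t φ v) = s ∧ ∀ x (r : ℝ), φ x ≤ r →
      inner ℝ (v - prox t φ v) (x - prox t φ v) ≤ t * (r - s) := by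
  obtain ⟨p, s, hps, h⟩ := hφ.exists_variational ht v
  rw [hφ.prox_eq_of_variational ht hps h]
  exact ⟨s, hps, h⟩

/-- The proximity operator is firmly nonexpansive. -/
lemma norm_prox_sub_prox_sq_le [CompleteSpace E] (hφ : IsGammaZero φ) {t : ℝ} (ht : 0 < t)
    (v w : E) :
    ‖prox t φ v - prox t φ w‖ ^ 2 ≤
      ‖v - w‖ ^ 2 - ‖(v - prox t φ v) - (w - prox t φ w)‖ ^ 2 := by
  obtain ⟨s, hs, h⟩ := hφ.prox_spec ht v
  obtain ⟨r, hr, h'⟩ := hφ.prox_spec ht w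
  have h1 := h _ r hr.le
  have h2 := h' _ s hs.le
  set p := prox t φ v
  set q := prox t φ w
  have e : v - w = ((v - p) - (w - q)) + (p - q) := by abel
  rw [e, norm_add_sq_real, inner_sub_left]
  have e2 : inner ℝ (v - p) (q - p) = - inner ℝ (v - p) (p - q) := by
    rw [← inner_neg_right, neg_sub]
  linarith

lemma fenchelConj_le_coe_iff (hφ : IsGammaZero φ) {y : E} {r : ℝ} :
    fenchelConj φ y ≤ r ↔ ∀ x (s : ℝ), φ x ≤ s → inner ℝ x y - s ≤ r := by
  rw [fenchelConj, iSup_le_iff]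
  refine forall_congr' fun x => ?_
  by_cases hx : φ x = ⊤
  · rw [hx]
    simp
  · obtain ⟨c, hc⟩ : ∃ r : ℝ, φ x = r := ⟨_, (EReal.coe_toReal hx (hφ.ne_bot x)).symm⟩
    rw [hc, ← EReal.coe_sub, EReal.coe_le_coe_iff]
    constructor
    · intro h s hs
      have := EReal.coe_le_coe_iff.1 hs
      linarith
    · intro h
      exact h c le_rfl

lemma fenchelConj [CompleteSpace E] (hφ : IsGammaZero φ) : IsGammaZero (fenchelConj φ) where
  ne_bot y h := by
    obtain ⟨x, c, hc⟩ := hφ.exists_coe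
    have := hφ.fenchelConj_le_coe_iff.1 (h.trans_le bot_le : _ ≤ ((inner ℝ x y - c - 1 : ℝ) : EReal))
      x c hc.le
    linarith
  exists_ne_top := by
    obtain ⟨a, b, hab⟩ := hφ.exists_affine_minorant
    -- The slope of an affine minorant lies in the domain of the conjugate.
    refine ⟨a, fun h => ?_⟩
    have : _root_.fenchelConj φ a ≤ (b : EReal) := hφ.fenchelConj_le_coe_iff.2 fun x s hs => by
      have := hab x s hs
      rw [real_inner_comm]
      linarith
    simp [h] at this
  lsc := by
    refine lowerSemicontinuous_iSup fun x => ?_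
    by_cases hx : φ x = ⊤
    · simpa [hx] using lowerSemicontinuous_const
    · obtain ⟨c, hc⟩ : ∃ r : ℝ, φ x = r := ⟨_, (EReal.coe_toReal hx (hφ.ne_bot x)).symm⟩
      simp only [hc, ← EReal.coe_sub]
      exact (continuous_coe_real_ereal.comp (by fun_prop)).lowerSemicontinuous
  convex := by
    intro p hp q hq a b ha hb hab
    rw [Set.mem_ofPred_eq, hφ.fenchelConj_le_coe_iff] at hp hq ⊢
    intro x s hs
    have h1 := mul_le_mul_of_nonneg_left (hp x s hs) ha
    have h2 := mul_le_mul_of_nonneg_left (hq x s hs) hb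
    have h3 : s = a * s + b * s := by rw [← add_mul, hab, one_mul]
    simp only [Prod.fst_add, Prod.smul_fst, Prod.snd_add, Prod.smul_snd, smul_eq_mul,
      inner_add_right, inner_smul_right]
    linarith

end IsGammaZero

/-! ### The composite nonsmooth term. -/

section NonsmoothPart

variable {H : Type*} [NormedAddCommGroup H] [InnerProductSpace ℝ H]
  {m : ℕ} {G : Fin m → Type*} [∀ i, NormedAddCommGroup (G i)] [∀ i, InnerProductSpace ℝ (G i)]
  {g : H → EReal} {h : ∀ i, G i → EReal}

/-- Joint semicontinuity in the point and the shift is what the perturbed problems need; zero shift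
recovers `nonsmoothPart`. -/
lemma lowerSemicontinuous_add_finsetSum_shift (hg : IsGammaZero g) (hh : ∀ i, IsGammaZero (h i))
    (B : ∀ i, H →L[ℝ] G i) :
    LowerSemicontinuous (fun q : H × (∀ i, G i) => g q.1 + ∑ i, h i (B i q.1 + q.2 i)) := by
  refine (hg.lsc.comp continuous_fst).add' (lowerSemicontinuous_finsetSum_ereal _
    (fun i => (hh i).lsc.comp (g := fun q : H × (∀ i, G i) => B i q.1 + q.2 i) (by fun_prop))
    fun i q => (hh i).ne_bot _) fun q => EReal.continuousAt_add
      (.inr (EReal.finsetSum_ne_bot Finset.univ fun i => (hh i).ne_bot (B i q.1 + q.2 i)))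
      (.inl (hg.ne_bot _))

lemma nonsmoothPart_ne_bot (hg : IsGammaZero g) (hh : ∀ i, IsGammaZero (h i))
    (B : ∀ i, H →L[ℝ] G i) (x : H) : nonsmoothPart g h B x ≠ ⊥ :=
  EReal.add_ne_bot_iff.2 ⟨hg.ne_bot _, EReal.finsetSum_ne_bot _ fun i => (hh i).ne_bot _⟩

lemma isGammaZero_nonsmoothPart (hg : IsGammaZero g) (hh : ∀ i, IsGammaZero (h i))
    (B : ∀ i, H →L[ℝ] G i) (hne : ∃ x, nonsmoothPart g h B x ≠ ⊤) :
    IsGammaZero (nonsmoothPart g h B) where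
  ne_bot := nonsmoothPart_ne_bot hg hh B
  exists_ne_top := hne
  lsc := by
    have := (lowerSemicontinuous_add_finsetSum_shift hg hh B).comp
      (g := fun x : H => (x, fun i => (0 : G i))) (by fun_prop)
    simp only [Function.comp_def, add_zero] at this
    exact this
  convex := by
    intro p hp q hq a b ha hb hab
    simp only [nonsmoothPart, Set.mem_ofPred_eq] at hp hq ⊢
    rw [EReal.add_finsetSum_le_coe_iff (hg.ne_bot _) fun i => (hh i).ne_bot _] at hp hq ⊢
    obtain ⟨s, t, hs, ht, hst⟩ := hp
    obtain ⟨s', t', hs', ht', hst'⟩ := hq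
    refine ⟨a * s + b * s', fun i => a * t i + b * t' i, ?_, fun i => ?_, ?_⟩
    · exact hg.convex (x := (p.1, s)) hs (y := (q.1, s')) hs' ha hb hab
    · have := (hh i).convex (x := (B i p.1, t i)) (ht i) (y := (B i q.1, t' i)) (ht' i) ha hb hab
      simpa using this
    · have h1 := mul_le_mul_of_nonneg_left hst ha
      have h2 := mul_le_mul_of_nonneg_left hst' hb
      simp only [Finset.sum_add_distrib, ← Finset.mul_sum, Prod.snd_add, Prod.smul_snd,
        smul_eq_mul]
      linarith

end NonsmoothPart

/-! ### Auxiliary facts for duality and descent. -/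

/-- If all sums of elements chosen from finitely many nonempty sets are at most `M`, then so is
the sum of suitable upper bounds of these sets. -/
lemma exists_upperBounds_sum_le {ι : Type*} [Fintype ι] {A : ι → Set ℝ}
    (hA : ∀ i, (A i).Nonempty) {M : ℝ} (hM : ∀ v : ι → ℝ, (∀ i, v i ∈ A i) → ∑ i, v i ≤ M) :
    ∃ c : ι → ℝ, (∀ i, c i ∈ upperBounds (A i)) ∧ ∑ i, c i ≤ M := by
  classical
  choose w hw using hA
  have hbdd : ∀ i, BddAbove (A i) := fun i => by
    refine ⟨M - ∑ j ∈ Finset.univ.erase i, w j, fun v hv => ?_⟩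
    have h1 := hM (Function.update w i v) fun j => by
      by_cases hj : j = i
      · subst hj; simpa using hv
      · simpa [hj] using hw j
    rw [← Finset.add_sum_erase _ _ (Finset.mem_univ i), Function.update_self,
      Finset.sum_congr rfl (g := w) fun j hj => by
        rw [Function.update_of_ne (Finset.ne_of_mem_erase hj)]] at h1
    linarith
  refine ⟨fun i => sSup (A i), fun i v hv => le_csSup (hbdd i) hv, ?_⟩
  refine le_of_forall_pos_le_add fun ε hε => ?_
  -- The `+ 1` keeps the denominator positive when `ι` is empty.
  set δ := ε / (Fintype.card ι + 1) with hδ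
  have hδ0 : 0 < δ := by positivity
  have hex : ∀ i, ∃ v ∈ A i, sSup (A i) - δ < v := fun i =>
    exists_lt_of_lt_csSup ⟨w i, hw i⟩ (sub_lt_self _ hδ0)
  choose v hv hlt using hex
  have h1 : ∑ i, (sSup (A i) - δ) ≤ ∑ i, v i := Finset.sum_le_sum fun i _ => (hlt i).le
  rw [Finset.sum_sub_distrib, Finset.sum_const, Finset.card_univ, nsmul_eq_mul] at h1
  have h2 : (Fintype.card ι : ℝ) * δ ≤ ε := by
    rw [hδ, mul_div_assoc', div_le_iff₀ (by positivity)]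
    nlinarith
  linarith [hM v hv]

lemma exists_strongDual_pi_eq_sum_inner {m : ℕ} {G : Fin m → Type*}
    [∀ i, NormedAddCommGroup (G i)] [∀ i, InnerProductSpace ℝ (G i)] [∀ i, CompleteSpace (G i)]
    (l : StrongDual ℝ (∀ i, G i)) : ∃ η : ∀ i, G i, ∀ z, l z = ∑ i, inner ℝ (η i) (z i) := by
  refine ⟨fun i => (InnerProductSpace.toDual ℝ (G i)).symm
    (l.comp (ContinuousLinearMap.single ℝ G i)), fun z => ?_⟩
  simp only [InnerProductSpace.toDual_symm_apply, ContinuousLinearMap.comp_apply,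
    ContinuousLinearMap.single_apply]
  rw [← map_sum, Finset.univ_sum_single]

/-- A descent sequence with a three-point inequality at a comparison value `ψ` falls below every
number greater than `ψ`. -/
lemma eventually_lt_of_descent {Ψ a d : ℕ → ℝ} {c K ψ M : ℝ} (hc : 0 < c) (hK : 0 ≤ K)
    (ha : ∀ j, 0 ≤ a j) (hd : ∀ j, 0 ≤ d j) (hM : ∀ j, M ≤ Ψ j)
    (h₁ : ∀ j, Ψ (j + 1) ≤ Ψ j - c * d j)
    (h₂ : ∀ j, Ψ (j + 1) ≤ ψ + K * d j + a j - a (j + 1)) {ε : ℝ} (hε : 0 < ε) :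
    ∀ᶠ j in atTop, Ψ j < ψ + ε := by
  have hanti : Antitone Ψ := antitone_nat_of_succ_le fun j =>
    (h₁ j).trans (by linarith [mul_nonneg hc.le (hd j)])
  suffices ∃ j, Ψ j < ψ + ε by
    obtain ⟨j, hj⟩ := this
    filter_upwards [eventually_ge_atTop j] with k hk
    exact (hanti hk).trans_lt hj
  by_contra! hno
  -- A Lyapunov function: the weight `K / c` lets the descent of `Ψ` pay for `K * d j`. If `Ψ` stays
  -- above `ψ + ε`, then `V` drops by `ε` at every step although it is bounded below.
  set V : ℕ → ℝ := fun j => K / c * Ψ j + a j with hV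
  have hstep : ∀ j, V (j + 1) ≤ V j - ε := fun j => by
    have h3 : K * d j ≤ K / c * (Ψ j - Ψ (j + 1)) := by
      rw [show K * d j = K / c * (c * d j) by field_simp]
      exact mul_le_mul_of_nonneg_left (by linarith [h₁ j]) (div_nonneg hK hc.le)
    simp only [hV]
    linarith [h₂ j, hno (j + 1)]
  have hlin : ∀ N : ℕ, V N ≤ V 0 - N * ε := fun N => by
    induction N with
    | zero => simp
    | succ N ih => push_cast; linarith [hstep N]
  have hlow : ∀ N, K / c * M ≤ V N := fun N => by
    have := mul_le_mul_of_nonneg_left (hM N) (div_nonneg hK hc.le)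
    simp only [hV]
    linarith [ha N]
  obtain ⟨N, hN⟩ := exists_nat_gt ((V 0 - K / c * M) / ε)
  rw [div_lt_iff₀ hε] at hN
  linarith [hlin N, hlow N]

/-! ### Duality for the proximal subproblem and the inner loop. -/

section Dual

variable {H : Type*} [NormedAddCommGroup H] [InnerProductSpace ℝ H] [CompleteSpace H]
  {m : ℕ} {G : Fin m → Type*} [∀ i, NormedAddCommGroup (G i)] [∀ i, InnerProductSpace ℝ (G i)]
  [∀ i, CompleteSpace (G i)] {g : H → EReal} {h : ∀ i, G i → EReal} {B : ∀ i, H →L[ℝ] G i}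
  {γ : ℝ} {u : H}

variable (g B γ u) in
/-- The minimum over `x` of the Lagrangian `‖x - u‖² / 2 + γ (g x + ∑ i, ⟨B_i x, y_i⟩)`. -/
noncomputable def lagrangianDual (y : ∀ i, G i) : ℝ :=
  ‖primalPoint g B γ u y - u‖ ^ 2 / 2 + γ * ((g (primalPoint g B γ u y)).toReal
    + ∑ i, inner ℝ (B i (primalPoint g B γ u y)) (y i))

variable (g h B γ u) in
/-- The objective of the dual problem, to be minimized. -/
noncomputable def dualObjective (y : ∀ i, G i) : ℝ :=
  γ * ∑ i, (fenchelConj (h i) (y i)).toReal - lagrangianDual g B γ u y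

lemma exists_coe_primalPoint (hg : IsGammaZero g) (hγ : 0 < γ) (y : ∀ i, G i) :
    g (primalPoint g B γ u y) = ((g (primalPoint g B γ u y)).toReal : ℝ) := by
  obtain ⟨s, hs, -⟩ := hg.prox_spec hγ (u - γ • ∑ i, ContinuousLinearMap.adjoint (B i) (y i))
  rw [primalPoint, hs, EReal.toReal_coe]

/-- Moving the adjoints across turns the variational inequality of the primal point into quadratic
growth of the Lagrangian around its minimizer. -/
lemma lagrangianDual_add_sq_le (hg : IsGammaZero g) (hγ : 0 < γ) (y : ∀ i, G i) {x : H} {r : ℝ}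
    (hx : g x ≤ r) :
    lagrangianDual g B γ u y + ‖x - primalPoint g B γ u y‖ ^ 2 / 2
      ≤ ‖x - u‖ ^ 2 / 2 + γ * (r + ∑ i, inner ℝ (B i x) (y i)) := by
  obtain ⟨s, hs, hvar⟩ :=
    hg.prox_spec hγ (u - γ • ∑ i, ContinuousLinearMap.adjoint (B i) (y i))
  rw [lagrangianDual]
  have h1 := hvar x r hx
  rw [← primalPoint] at h1 hs
  set p := primalPoint g B γ u y
  rw [hs, EReal.toReal_coe]
  have e1 : inner ℝ (∑ i, ContinuousLinearMap.adjoint (B i) (y i)) (x - p)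
      = ∑ i, inner ℝ (B i x) (y i) - ∑ i, inner ℝ (B i p) (y i) := by
    rw [sum_inner, ← Finset.sum_sub_distrib]
    refine Finset.sum_congr rfl fun i _ => ?_
    rw [ContinuousLinearMap.adjoint_inner_left, map_sub, inner_sub_right, real_inner_comm,
      real_inner_comm (B i p)]
  rw [sub_right_comm, inner_sub_left, inner_smul_left, e1, conj_trivial] at h1
  rw [norm_sub_sq_eq_add_add_inner x p u]
  linarith

/-- Concavity, with supergradient `γ B_i p`: the primal point of `y` is a competitor in the minimum
that defines the dual value at `z`. -/
lemma lagrangianDual_le (hg : IsGammaZero g) (hγ : 0 < γ) (y z : ∀ i, G i) :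
    lagrangianDual g B γ u z ≤ lagrangianDual g B γ u y
      + γ * ∑ i, inner ℝ (B i (primalPoint g B γ u y)) (z i - y i) := by
  have h1 := lagrangianDual_add_sq_le (B := B) (u := u) hg hγ z
    (exists_coe_primalPoint (B := B) (u := u) hg hγ y).le
  rw [lagrangianDual.eq_1 g B γ u y]
  simp only [inner_sub_right, Finset.sum_sub_distrib]
  nlinarith [sq_nonneg ‖primalPoint g B γ u y - primalPoint g B γ u z‖]

lemma le_lagrangianDual (hg : IsGammaZero g) (hγ : 0 < γ) (y z : ∀ i, G i) :
    lagrangianDual g B γ u y + γ * ∑ i, inner ℝ (B i (primalPoint g B γ u y)) (z i - y i)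
      - γ ^ 2 * (∑ i, ‖B i‖ ^ 2) / 2 * ∑ i, ‖z i - y i‖ ^ 2 ≤ lagrangianDual g B γ u z := by
  have h1 := lagrangianDual_add_sq_le (B := B) (u := u) hg hγ y
    (exists_coe_primalPoint (B := B) (u := u) hg hγ z).le
  rw [lagrangianDual.eq_1 g B γ u z]
  set p := primalPoint g B γ u y
  set q := primalPoint g B γ u z
  have e1 : ∑ i, inner ℝ (B i q) (z i) - ∑ i, inner ℝ (B i q) (y i)
      = ∑ i, inner ℝ (B i p) (z i - y i) + ∑ i, inner ℝ (B i (q - p)) (z i - y i) := by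
    simp only [map_sub, inner_sub_left, inner_sub_right, Finset.sum_sub_distrib]
    ring
  have h2 : -(‖q - p‖ * ∑ i, ‖B i‖ * ‖z i - y i‖) ≤ ∑ i, inner ℝ (B i (q - p)) (z i - y i) := by
    rw [Finset.mul_sum, ← Finset.sum_neg_distrib]
    refine Finset.sum_le_sum fun i _ => ?_
    have h3 := neg_le_of_abs_le (abs_real_inner_le_norm (B i (q - p)) (z i - y i))
    have h4 := mul_le_mul_of_nonneg_right ((B i).le_opNorm (q - p)) (norm_nonneg (z i - y i))
    linarith
  have h3 := Finset.sum_mul_sq_le_sq_mul_sq Finset.univ (fun i => ‖B i‖) fun i => ‖z i - y i‖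
  set S := ∑ i, ‖B i‖ * ‖z i - y i‖
  have h4 := mul_le_mul_of_nonneg_left h2 hγ.le
  have h5 := mul_le_mul_of_nonneg_left h3 (by positivity : 0 ≤ γ ^ 2 / 2)
  have h6 : γ * ∑ i, inner ℝ (B i q) (z i) = γ * ∑ i, inner ℝ (B i q) (y i)
      + γ * ∑ i, inner ℝ (B i p) (z i - y i) + γ * ∑ i, inner ℝ (B i (q - p)) (z i - y i) := by
    rw [← mul_add, ← mul_add]
    congr 1
    linarith
  -- Quadratic growth absorbs the cross term `γ S ‖q - p‖` at the cost of `γ² S² / 2`, which `h5`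
  -- bounds by Cauchy-Schwarz.
  nlinarith [sq_nonneg (‖q - p‖ - γ * S)]

/-- The three-point inequality of one dual forward-backward step from `y` to `y'`. -/
lemma dualObjective_step_le (hg : IsGammaZero g) (hh : ∀ i, IsGammaZero (h i)) (hγ : 0 < γ)
    {lam : ℝ} (hlam : 0 < lam) {y y' z : ∀ i, G i}
    (hstep : ∀ i, y' i = prox (lam / γ) (fenchelConj (h i))
      (y i + (lam / γ) • B i (primalPoint g B γ u y)))
    (hz : ∀ i, fenchelConj (h i) (z i) ≠ ⊤) :
    dualObjective g h B γ u y' ≤ dualObjective g h B γ u z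
      + γ ^ 2 / 2 * (∑ i, ‖B i‖ ^ 2 - 1 / lam) * ∑ i, ‖y' i - y i‖ ^ 2
      + γ ^ 2 / (2 * lam) * (∑ i, ‖z i - y i‖ ^ 2 - ∑ i, ‖z i - y' i‖ ^ 2) := by
  have h1 := le_lagrangianDual (B := B) (u := u) hg hγ y y'
  have h2 := lagrangianDual_le (B := B) (u := u) hg hγ y z
  set p := primalPoint g B γ u y
  -- The variational inequality of the dual prox, scaled by `γ² / lam`, the inverse of the dual step
  -- size.
  have h3 : ∀ i, γ ^ 2 / (2 * lam) * (‖y' i - y i‖ ^ 2 + ‖z i - y' i‖ ^ 2 - ‖z i - y i‖ ^ 2)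
      + γ * inner ℝ (B i p) (z i - y' i)
      ≤ γ * ((fenchelConj (h i) (z i)).toReal - (fenchelConj (h i) (y' i)).toReal) := fun i => by
    obtain ⟨s, hs, hvar⟩ := (hh i).fenchelConj.prox_spec (div_pos hlam hγ)
      (y i + (lam / γ) • B i p)
    rw [← hstep i] at hs hvar
    have h4 := hvar (z i) _ (EReal.coe_toReal (hz i) ((hh i).fenchelConj.ne_bot _)).ge
    rw [hs, EReal.toReal_coe]
    rw [add_sub_right_comm, inner_add_left, inner_smul_left, conj_trivial] at h4
    have h5 := mul_le_mul_of_nonneg_left h4 (by positivity : 0 ≤ γ ^ 2 / lam)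
    have e1 : inner ℝ (y i - y' i) (z i - y' i)
        = (‖y' i - y i‖ ^ 2 + ‖z i - y' i‖ ^ 2 - ‖z i - y i‖ ^ 2) / 2 := by
      rw [norm_sub_sq_eq_add_add_inner (z i) (y' i) (y i)]
      ring
    rw [e1] at h5
    calc _ = γ ^ 2 / lam * ((‖y' i - y i‖ ^ 2 + ‖z i - y' i‖ ^ 2 - ‖z i - y i‖ ^ 2) / 2
          + lam / γ * inner ℝ (B i p) (z i - y' i)) := by field_simp
      _ ≤ _ := h5
      _ = _ := by field_simp
  have h4 := Finset.sum_le_sum fun i (_ : i ∈ Finset.univ) => h3 i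
  simp only [Finset.sum_add_distrib, ← Finset.mul_sum, Finset.sum_sub_distrib] at h4
  have e2 : γ * ∑ i, inner ℝ (B i p) (z i - y i)
      = γ * ∑ i, inner ℝ (B i p) (y' i - y i) + γ * ∑ i, inner ℝ (B i p) (z i - y' i) := by
    rw [← mul_add, ← Finset.sum_add_distrib]
    congr 1
    refine Finset.sum_congr rfl fun i _ => ?_
    rw [← inner_add_right]
    congr 1
    abel
  have e3 : γ ^ 2 / 2 * (∑ i, ‖B i‖ ^ 2 - 1 / lam) * ∑ i, ‖y' i - y i‖ ^ 2
      = γ ^ 2 * (∑ i, ‖B i‖ ^ 2) / 2 * ∑ i, ‖y' i - y i‖ ^ 2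
        - γ ^ 2 / (2 * lam) * ∑ i, ‖y' i - y i‖ ^ 2 := by
    field_simp
  rw [dualObjective, dualObjective, e3]
  linarith

/-- Weak duality, with the distance of the primal point to the solution. -/
lemma norm_sub_primalPoint_sq_le (hg : IsGammaZero g) (hh : ∀ i, IsGammaZero (h i)) (hγ : 0 < γ)
    {x : H} {r : ℝ} (hx : nonsmoothPart g h B x ≤ r) {y : ∀ i, G i}
    (hy : ∀ i, fenchelConj (h i) (y i) ≠ ⊤) :
    ‖x - primalPoint g B γ u y‖ ^ 2 / 2
      ≤ ‖x - u‖ ^ 2 / 2 + γ * r + dualObjective g h B γ u y := by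
  obtain ⟨s, t, hs, ht, hst⟩ := (EReal.add_finsetSum_le_coe_iff (hg.ne_bot _)
    fun i => (hh i).ne_bot _).1 hx
  have h1 := lagrangianDual_add_sq_le (B := B) (u := u) hg hγ y hs
  have h2 : ∑ i, (inner ℝ (B i x) (y i) - t i) ≤ ∑ i, (fenchelConj (h i) (y i)).toReal :=
    Finset.sum_le_sum fun i _ => (hh i).fenchelConj_le_coe_iff.1
      (EReal.coe_toReal (hy i) ((hh i).fenchelConj.ne_bot _)).ge _ _ (ht i)
  rw [Finset.sum_sub_distrib] at h2
  rw [dualObjective]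
  nlinarith

variable (g h B γ u) in
/-- The epigraph of the value function of the perturbed problems
`min ‖x - u‖² / 2 + γ (g x + ∑ i, h_i (B_i x + z_i))`. -/
def perturbationEpigraph : Set ((∀ i, G i) × ℝ) :=
  {q | ∃ (x : H) (s : ℝ) (t : Fin m → ℝ), g x ≤ s ∧ (∀ i, h i (B i x + q.1 i) ≤ t i) ∧
    ‖x - u‖ ^ 2 / 2 + γ * (s + ∑ i, t i) ≤ q.2}

omit [CompleteSpace H] [∀ i, CompleteSpace (G i)] in
lemma convex_perturbationEpigraph (hg : IsGammaZero g) (hh : ∀ i, IsGammaZero (h i)) :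
    Convex ℝ (perturbationEpigraph g h B γ u) := by
  rintro q ⟨x, s, t, hs, ht, hst⟩ q' ⟨x', s', t', hs', ht', hst'⟩ a b ha hb hab
  refine ⟨a • x + b • x', a * s + b * s', fun i => a * t i + b * t' i, ?_, fun i => ?_, ?_⟩
  · exact hg.convex (x := (x, s)) hs (y := (x', s')) hs' ha hb hab
  · have := (hh i).convex (x := (B i x + q.1 i, t i)) (ht i) (y := (B i x' + q'.1 i, t' i)) (ht' i)
      ha hb hab
    have e : B i (a • x + b • x') + (a • q + b • q').1 i
        = a • (B i x + q.1 i) + b • (B i x' + q'.1 i) := by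
      simp only [map_add, map_smul, Prod.fst_add, Prod.smul_fst, Pi.add_apply, Pi.smul_apply,
        smul_add]
      abel
    rw [e]
    simpa using this
  · have h1 := mul_le_mul_of_nonneg_left hst ha
    have h2 := mul_le_mul_of_nonneg_left hst' hb
    have h3 := ((convexOn_norm (E := H) convex_univ).pow (fun _ _ => norm_nonneg _) 2).2
      (Set.mem_univ (x - u)) (Set.mem_univ (x' - u)) ha hb hab
    have e : a • (x - u) + b • (x' - u) = a • x + b • x' - u := by
      rw [smul_sub, smul_sub, sub_add_sub_comm, ← add_smul, hab, one_smul]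
    simp only [e, Pi.pow_apply, smul_eq_mul] at h3
    simp only [Finset.sum_add_distrib, ← Finset.mul_sum, Prod.snd_add, Prod.smul_snd, smul_eq_mul]
    linarith

/-- The value function of the perturbed problems is lower semicontinuous at `0`. -/
lemma notMem_closure_perturbationEpigraph [FiniteDimensional ℝ H] (hg : IsGammaZero g)
    (hh : ∀ i, IsGammaZero (h i)) (hγ : 0 < γ) {P ε : ℝ} (hε : 0 < ε)
    (hP : ∀ x (r : ℝ), nonsmoothPart g h B x ≤ r → P ≤ ‖x - u‖ ^ 2 / 2 + γ * r) :
    ((0 : ∀ i, G i), P - ε) ∉ closure (perturbationEpigraph g h B γ u) := by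
  have : ProperSpace H := FiniteDimensional.proper_real H
  intro hmem
  obtain ⟨q, hq, hlim⟩ := mem_closure_iff_seq_limit.1 hmem
  choose x s t hs ht hst using hq
  have hz : Tendsto (fun n => (q n).1) atTop (𝓝 0) := (continuous_fst.tendsto _).comp hlim
  have hr : Tendsto (fun n => (q n).2) atTop (𝓝 (P - ε)) := (continuous_snd.tendsto _).comp hlim
  obtain ⟨a, b, hab⟩ := hg.exists_affine_minorant
  have hmin := fun i => (hh i).exists_affine_minorant
  choose c d hcd using hmin
  set a' : H := a + ∑ i, ContinuousLinearMap.adjoint (B i) (c i) with ha'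
  set κ : ℕ → ℝ := fun n => ∑ i, (inner ℝ (c i) ((q n).1 i) - d i) - b with hκ
  -- The affine minorants of `g` and all `h i` add up to one for the perturbed sum, with `κ n`
  -- collecting the part independent of `x n`.
  have hlow : ∀ n, inner ℝ a' (x n) + κ n ≤ s n + ∑ i, t n i := fun n => by
    have h1 := hab _ _ (hs n)
    have h2 := Finset.sum_le_sum fun i (_ : i ∈ Finset.univ) => hcd i _ _ (ht n i)
    simp only [inner_add_right, Finset.sum_add_distrib, Finset.sum_sub_distrib] at h2
    simp only [hκ, ha', inner_add_left, sum_inner, ContinuousLinearMap.adjoint_inner_left,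
      Finset.sum_sub_distrib]
    linarith
  have hκlim : Tendsto κ atTop (𝓝 (∑ i, (inner ℝ (c i) (0 : G i) - d i) - b)) := by
    refine Tendsto.sub_const (tendsto_finsetSum _ fun i _ => ?_) b
    exact (((continuous_const.inner continuous_id).tendsto (0 : G i)).comp
      ((tendsto_pi_nhds.1 hz) i)).sub_const (d i)
  obtain ⟨R, hR⟩ := ((hr.sub (hκlim.const_mul γ)).const_mul 2).bddAbove_range
  -- Completing the square bounds `‖x n - u + γ • a'‖ ^ 2`; the `+ 1` passes from the square to the
  -- norm.
  have hbound : ∀ n, x n ∈ Metric.closedBall (u - γ • a')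
      (R - 2 * γ * inner ℝ a' u + γ ^ 2 * ‖a'‖ ^ 2 + 1) := fun n => by
    rw [mem_closedBall_iff_norm, show x n - (u - γ • a') = (x n - u) + γ • a' by abel]
    have h1 : 2 * ((q n).2 - γ * κ n) ≤ R := hR ⟨n, rfl⟩
    have h2 := mul_le_mul_of_nonneg_left (hlow n) hγ.le
    have h3 := norm_add_sq_real (x n - u) (γ • a')
    rw [inner_smul_right, norm_smul, Real.norm_of_nonneg hγ.le, real_inner_comm,
      inner_sub_right] at h3
    nlinarith [hst n, sq_nonneg (‖x n - u + γ • a'‖ - 1)]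
  obtain ⟨w, -, φ, hφ, hw⟩ := tendsto_subseq_of_bounded Metric.isBounded_closedBall hbound
  -- Only the total height is passed to the limit, since `s n` and `t n` need not converge
  -- separately.
  set σ : ℕ → ℝ := fun n => ((q n).2 - ‖x n - u‖ ^ 2 / 2) / γ with hσ
  have hepi : ∀ n, g (x n) + ∑ i, h i (B i (x n) + (q n).1 i) ≤ (σ n : EReal) := fun n => by
    refine (EReal.add_finsetSum_le_coe_iff (hg.ne_bot _) fun i => (hh i).ne_bot _).2
      ⟨s n, t n, hs n, ht n, ?_⟩
    simp only [hσ]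
    rw [le_div_iff₀ hγ]
    linarith [hst n]
  have hσlim : Tendsto (fun n => σ (φ n)) atTop (𝓝 ((P - ε - ‖w - u‖ ^ 2 / 2) / γ)) :=
    ((hr.comp hφ.tendsto_atTop).sub (((hw.sub_const u).norm.pow 2).div_const 2)).div_const γ
  have hclosed : IsClosed {p : (H × (∀ i, G i)) × ℝ |
      g p.1.1 + ∑ i, h i (B i p.1.1 + p.1.2 i) ≤ (p.2 : EReal)} :=
    (lowerSemicontinuous_add_finsetSum_shift hg hh B).isClosed_epigraph.preimage
      (continuous_fst.prodMk (continuous_coe_real_ereal.comp continuous_snd))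
  have hfin := hclosed.mem_of_tendsto
    ((hw.prodMk_nhds (hz.comp hφ.tendsto_atTop)).prodMk_nhds hσlim)
    (Eventually.of_forall fun n => hepi (φ n))
  have h1 := hP w ((P - ε - ‖w - u‖ ^ 2 / 2) / γ) (by simpa [nonsmoothPart] using hfin)
  rw [mul_div_cancel₀ _ hγ.ne'] at h1
  linarith

/-- There is no duality gap. -/
lemma exists_dualObjective_le [FiniteDimensional ℝ H] (hg : IsGammaZero g)
    (hh : ∀ i, IsGammaZero (h i)) (hγ : 0 < γ) {P ε : ℝ} (hε : 0 < ε)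
    (hne : ∃ x, nonsmoothPart g h B x ≠ ⊤)
    (hP : ∀ x (r : ℝ), nonsmoothPart g h B x ≤ r → P ≤ ‖x - u‖ ^ 2 / 2 + γ * r) :
    ∃ z : ∀ i, G i, (∀ i, fenchelConj (h i) (z i) ≠ ⊤) ∧
      dualObjective g h B γ u z ≤ -P + ε := by
  obtain ⟨x₀, hx₀⟩ := hne
  obtain ⟨r₀, hr₀⟩ : ∃ r : ℝ, nonsmoothPart g h B x₀ = r :=
    ⟨_, (EReal.coe_toReal hx₀ (nonsmoothPart_ne_bot hg hh B x₀)).symm⟩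
  obtain ⟨s₀, t₀, hs₀, ht₀, -⟩ := (EReal.add_finsetSum_le_coe_iff (hg.ne_bot _)
    fun i => (hh i).ne_bot _).1 hr₀.le
  obtain ⟨l, hl⟩ := exists_affine_minorant_of_notMem_closure
    (convex_perturbationEpigraph (B := B) (γ := γ) (u := u) hg hh)
    (by
      rintro z r r' ⟨x, s, t, hs, ht, hst⟩ hr
      exact ⟨x, s, t, hs, ht, hst.trans hr⟩)
    (r₁ := ‖x₀ - u‖ ^ 2 / 2 + γ * (s₀ + ∑ i, t₀ i))
    ⟨x₀, s₀, t₀, hs₀, fun i => by simpa using ht₀ i, le_rfl⟩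
    (notMem_closure_perturbationEpigraph hg hh hγ hε hP)
  obtain ⟨η, hη⟩ := exists_strongDual_pi_eq_sum_inner l
  -- The slope of the separating affine function, rescaled by `γ`, is the nearly optimal dual
  -- vector.
  set ζ : ∀ i, G i := fun i => γ⁻¹ • η i with hζ
  set p := primalPoint g B γ u ζ with hp
  set A : Fin m → Set ℝ := fun i => {v | ∃ (w : G i) (t : ℝ), h i w ≤ t ∧ v = inner ℝ w (ζ i) - t}
    with hA
  obtain ⟨c, hc, hcM⟩ := exists_upperBounds_sum_le (A := A)
    (M := (lagrangianDual g B γ u ζ - P + ε) / γ)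
    (fun i => by
      obtain ⟨w, t, hw⟩ := (hh i).exists_coe
      exact ⟨_, w, t, hw.le, rfl⟩)
    (by
      intro v hv
      choose w t hw hvw using hv
      -- This perturbation moves `B i p` to the arbitrary point `w i`, so the separation bounds the
      -- sum of all conjugates jointly; `exists_upperBounds_sum_le` then splits the bound.
      have h1 := hl (fun i => w i - B i p) (‖p - u‖ ^ 2 / 2 + γ * ((g p).toReal + ∑ i, t i))
        ⟨p, (g p).toReal, t, (exists_coe_primalPoint hg hγ ζ).le, fun i => by simpa using hw i,
          le_rfl⟩
      have h2 : ∑ i, inner ℝ (η i) (w i - B i p)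
          = γ * ∑ i, inner ℝ (w i) (ζ i) - γ * ∑ i, inner ℝ (B i p) (ζ i) := by
        rw [Finset.mul_sum, Finset.mul_sum, ← Finset.sum_sub_distrib]
        refine Finset.sum_congr rfl fun i _ => ?_
        simp only [hζ, inner_smul_right]
        rw [mul_inv_cancel_left₀ hγ.ne', mul_inv_cancel_left₀ hγ.ne', inner_sub_right,
          real_inner_comm, real_inner_comm (B i p)]
      rw [sub_zero, hη, h2] at h1
      rw [le_div_iff₀ hγ, lagrangianDual, ← hp]
      simp only [hvw, Finset.sum_sub_distrib]
      linarith)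
  have hle : ∀ i, fenchelConj (h i) (ζ i) ≤ c i := fun i =>
    (hh i).fenchelConj_le_coe_iff.2 fun w t hw => hc i ⟨w, t, hw, rfl⟩
  have hnt : ∀ i, fenchelConj (h i) (ζ i) ≠ ⊤ := fun i h' => by
    have := hle i
    simp [h'] at this
  refine ⟨ζ, hnt, ?_⟩
  have h3 : ∑ i, (fenchelConj (h i) (ζ i)).toReal ≤ ∑ i, c i := Finset.sum_le_sum fun i _ => by
    rw [← EReal.coe_le_coe_iff, EReal.coe_toReal (hnt i) ((hh i).fenchelConj.ne_bot _)]
    exact hle i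
  rw [le_div_iff₀ hγ] at hcM
  rw [dualObjective]
  nlinarith

/-- The primal points of the dual forward-backward iteration converge to the proximal point. -/
theorem tendsto_primalPoint [FiniteDimensional ℝ H] (hg : IsGammaZero g)
    (hh : ∀ i, IsGammaZero (h i)) (hγ : 0 < γ) {lam : ℝ} (hlam : 0 < lam)
    (hlamB : lam * ∑ i, ‖B i‖ ^ 2 < 2) (hne : ∃ x, nonsmoothPart g h B x ≠ ⊤)
    {y : ℕ → ∀ i, G i}
    (hstep : ∀ j i, y (j + 1) i = prox (lam / γ) (fenchelConj (h i))
      (y j i + (lam / γ) • B i (primalPoint g B γ u (y j)))) :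
    Tendsto (fun j => primalPoint g B γ u (y j)) atTop (𝓝 (prox γ (nonsmoothPart g h B) u)) := by
  obtain ⟨s, hs, hvar⟩ := (isGammaZero_nonsmoothPart hg hh B hne).prox_spec hγ u
  set q := prox γ (nonsmoothPart g h B) u
  -- The starting vector may lie outside the domain of the conjugates, but every prox output lies
  -- inside; hence the shift to `j + 1` below.
  have hdom : ∀ j i, fenchelConj (h i) (y (j + 1) i) ≠ ⊤ := fun j i => by
    obtain ⟨r, hr, -⟩ := (hh i).fenchelConj.prox_spec (div_pos hlam hγ)
      (y j i + (lam / γ) • B i (primalPoint g B γ u (y j)))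
    rw [hstep j i, hr]
    exact EReal.coe_ne_top r
  have hdist := fun j => norm_sub_primalPoint_sq_le (u := u) hg hh hγ hs.le (hdom j)
  set P := ‖q - u‖ ^ 2 / 2 + γ * s with hP
  have hopt : ∀ x (r : ℝ), nonsmoothPart g h B x ≤ r → P ≤ ‖x - u‖ ^ 2 / 2 + γ * r :=
    fun x r hx => by
      have := hvar x r hx
      rw [hP, norm_sub_sq_eq_add_add_inner x q u]
      nlinarith [sq_nonneg ‖x - q‖]
  -- The descent constant, positive exactly because `lam * ∑ i, ‖B i‖ ^ 2 < 2`.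
  have hc : 0 < γ ^ 2 / 2 * (2 / lam - ∑ i, ‖B i‖ ^ 2) := by
    refine mul_pos (by positivity) (sub_pos.2 ?_)
    rw [lt_div_iff₀ hlam]
    linarith
  have hev : ∀ ε : ℝ, 0 < ε → ∀ᶠ j in atTop, dualObjective g h B γ u (y (j + 1)) < -P + ε := by
    intro ε hε
    -- An `ε / 2`-optimal comparison vector replaces a dual minimizer. Below, the three-point
    -- inequality at the current iterate gives descent, and at `z` it gives the comparison.
    obtain ⟨z, hz, hzle⟩ := exists_dualObjective_le hg hh hγ (half_pos hε) hne hopt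
    have hdesc := eventually_lt_of_descent (Ψ := fun j => dualObjective g h B γ u (y (j + 1)))
      (a := fun j => γ ^ 2 / (2 * lam) * ∑ i, ‖z i - y (j + 1) i‖ ^ 2)
      (d := fun j => ∑ i, ‖y (j + 2) i - y (j + 1) i‖ ^ 2) (ψ := dualObjective g h B γ u z)
      (K := γ ^ 2 / 2 * ∑ i, ‖B i‖ ^ 2) (M := -P)
      hc (by positivity) (fun j => by positivity) (fun j => by positivity)
      (fun j => by
        have := hdist j
        nlinarith [sq_nonneg ‖q - primalPoint g B γ u (y (j + 1))‖])
      (fun j => by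
        have h1 := dualObjective_step_le hg hh hγ hlam (hstep (j + 1)) (hdom j)
        have e : γ ^ 2 / 2 * (2 / lam - ∑ i, ‖B i‖ ^ 2)
            = -(γ ^ 2 / 2 * (∑ i, ‖B i‖ ^ 2 - 1 / lam)) + γ ^ 2 / (2 * lam) := by
          field_simp; ring
        simp only [sub_self, norm_zero, ne_eq, OfNat.ofNat_ne_zero, not_false_eq_true, zero_pow,
          Finset.sum_const_zero, norm_sub_rev (y (j + 1) _)] at h1
        rw [e]
        linarith)
      (fun j => by
        have h1 := dualObjective_step_le hg hh hγ hlam (hstep (j + 1)) hz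
        have h2 : 0 ≤ γ ^ 2 / 2 * (1 / lam) * ∑ i, ‖y (j + 2) i - y (j + 1) i‖ ^ 2 := by positivity
        linarith)
      (half_pos hε)
    filter_upwards [hdesc] with j hj
    linarith
  refine (tendsto_add_atTop_iff_nat 1).1 (Metric.tendsto_atTop'.2 fun δ hδ => ?_)
  obtain ⟨N, hN⟩ := eventually_atTop.1 (hev (δ ^ 2 / 2) (by positivity))
  refine ⟨N, fun j hj => ?_⟩
  rw [dist_comm, dist_eq_norm]
  refine lt_of_pow_lt_pow_left₀ 2 hδ.le ?_
  linarith [hdist j, hN j hj.le]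

end Dual

/-! ### The outer forward-backward map. -/

section ForwardBackward

variable {H : Type*} [NormedAddCommGroup H] [InnerProductSpace ℝ H] [CompleteSpace H]
  {f : H → ℝ} {F : H → EReal} {L : ℝ≥0} {γ : ℝ}

lemma norm_forwardBackward_sub_sq_le (hL0 : 0 < L) (hc : ConvexOn ℝ Set.univ f)
    (hf : Differentiable ℝ f) (hL : LipschitzWith L (gradient f)) (hF : IsGammaZero F)
    (hγ : 0 < γ) (x y : H) :
    ‖prox γ F (x - γ • gradient f x) - prox γ F (y - γ • gradient f y)‖ ^ 2
      ≤ ‖x - y‖ ^ 2 - γ * (2 / L - γ) * ‖gradient f x - gradient f y‖ ^ 2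
        - ‖(x - γ • gradient f x - prox γ F (x - γ • gradient f x))
          - (y - γ • gradient f y - prox γ F (y - γ • gradient f y))‖ ^ 2 :=
  (hF.norm_prox_sub_prox_sq_le hγ _ _).trans
    (sub_le_sub_right (norm_gradient_step_sub_sq_le hL0 hc hf hL hγ x y) _)

lemma lipschitzWith_forwardBackward (hL0 : 0 < L) (hc : ConvexOn ℝ Set.univ f)
    (hf : Differentiable ℝ f) (hL : LipschitzWith L (gradient f)) (hF : IsGammaZero F)
    (hγ : 0 < γ) (hγL : γ < 2 / L) :
    LipschitzWith 1 (fun x => prox γ F (x - γ • gradient f x)) := by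
  refine LipschitzWith.of_dist_le_mul fun x y => ?_
  rw [dist_eq_norm, dist_eq_norm, NNReal.coe_one, one_mul]
  refine le_of_sq_le_sq ?_ (norm_nonneg _)
  have h1 := norm_forwardBackward_sub_sq_le hL0 hc hf hL hF hγ x y
  have h2 : 0 ≤ γ * (2 / L - γ) * ‖gradient f x - gradient f y‖ ^ 2 :=
    mul_nonneg (mul_nonneg hγ.le (sub_pos.2 hγL).le) (sq_nonneg _)
  linarith [sq_nonneg ‖(x - γ • gradient f x - prox γ F (x - γ • gradient f x))
          - (y - γ • gradient f y - prox γ F (y - γ • gradient f y))‖]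

/-- If the distance did not shrink, both subtracted squares would vanish: the gradients at `x` and
`z` agree, and then so do the displacements, which makes `x` fixed. -/
lemma norm_forwardBackward_sub_lt (hL0 : 0 < L) (hc : ConvexOn ℝ Set.univ f)
    (hf : Differentiable ℝ f) (hL : LipschitzWith L (gradient f)) (hF : IsGammaZero F)
    (hγ : 0 < γ) (hγL : γ < 2 / L) {z x : H} (hz : prox γ F (z - γ • gradient f z) = z)
    (hx : prox γ F (x - γ • gradient f x) ≠ x) :
    ‖prox γ F (x - γ • gradient f x) - z‖ < ‖x - z‖ := by
  by_contra! hle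
  have h1 := norm_forwardBackward_sub_sq_le hL0 hc hf hL hF hγ x z
  rw [hz] at h1
  have h2 := pow_le_pow_left₀ (norm_nonneg _) hle 2
  have hk : 0 < γ * (2 / L - γ) := mul_pos hγ (sub_pos.2 hγL)
  have h3 : ‖gradient f x - gradient f z‖ ^ 2 ≤ 0 := by
    by_contra! hpos
    nlinarith [mul_pos hk hpos, sq_nonneg ‖(x - γ • gradient f x - prox γ F (x - γ • gradient f x))
          - (z - γ • gradient f z - z)‖]
  have h4 : gradient f x = gradient f z := by
    rw [← sub_eq_zero, ← norm_eq_zero]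
    exact pow_eq_zero_iff two_ne_zero |>.1 (le_antisymm h3 (sq_nonneg _))
  have h5 : ‖(x - γ • gradient f x - prox γ F (x - γ • gradient f x))
          - (z - γ • gradient f z - z)‖ ^ 2 ≤ 0 := by
    nlinarith [mul_nonneg hk.le (sq_nonneg ‖gradient f x - gradient f z‖)]
  have h6 := norm_eq_zero.1 (pow_eq_zero_iff two_ne_zero |>.1 (le_antisymm h5 (sq_nonneg _)))
  refine hx (sub_eq_zero.1 ?_)
  rw [← neg_eq_zero, ← h6, ← h4]
  abel

lemma prox_forward_eq_self_of_isMinimizer (hf : Differentiable ℝ f)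
    (hL : LipschitzWith L (gradient f)) (hF : IsGammaZero F) (hγ : 0 < γ) {x : H}
    (hx : F x ≠ ⊤) (hmin : ∀ z, (f x : EReal) + F x ≤ (f z : EReal) + F z) :
    prox γ F (x - γ • gradient f x) = x := by
  obtain ⟨s, hs⟩ : ∃ s : ℝ, F x = s := ⟨_, (EReal.coe_toReal hx (hF.ne_bot x)).symm⟩
  refine hF.prox_eq_of_variational hγ hs fun w r hw => ?_
  have hkey : 0 ≤ inner ℝ (gradient f x) (w - x) + (r - s) := by
    refine nonneg_of_forall_add_mul_nonneg (b := L / 2 * ‖w - x‖ ^ 2) fun θ h0 h1 => ?_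
    have h2 := (hmin _).trans (add_le_add_right (hF.combo hs.le hw h0.le h1) _)
    rw [hs] at h2
    norm_cast at h2
    -- The quadratic model turns minimality along the segment into a first-order condition, with a
    -- remainder of order `θ ^ 2`.
    have h3 := hL.le_add_inner_gradient_add_sq hf x (x + θ • (w - x))
    rw [add_sub_cancel_left, inner_smul_right, norm_smul, Real.norm_of_nonneg h0.le] at h3
    refine nonneg_of_mul_nonneg_right (a := θ) ?_ h0
    nlinarith
  rw [sub_sub_cancel_left, inner_neg_left, inner_smul_left, conj_trivial]
  nlinarith

lemma isMinimizer_of_prox_forward_eq_self (hc : ConvexOn ℝ Set.univ f) (hf : Differentiable ℝ f)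
    (hF : IsGammaZero F) (hγ : 0 < γ) {x : H} (hx : prox γ F (x - γ • gradient f x) = x) :
    (f x : EReal) + F x ≠ ⊤ ∧ ∀ z, (f x : EReal) + F x ≤ (f z : EReal) + F z := by
  obtain ⟨s, hs, hvar⟩ := hF.prox_spec hγ (x - γ • gradient f x)
  rw [hx] at hs hvar
  rw [hs]
  refine ⟨by rw [← EReal.coe_add]; exact EReal.coe_ne_top _, fun z => ?_⟩
  by_cases hz : F z = ⊤
  · rw [hz, EReal.coe_add_top]
    exact le_top
  · obtain ⟨r, hr⟩ : ∃ r : ℝ, F z = r := ⟨_, (EReal.coe_toReal hz (hF.ne_bot z)).symm⟩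
    rw [hr]
    norm_cast
    have h1 := hvar z r hr.le
    rw [sub_sub_cancel_left, inner_neg_left, inner_smul_left, conj_trivial] at h1
    have h2 := hc.add_inner_gradient_le hf x z
    have h3 : 0 ≤ r - s + inner ℝ (gradient f x) (z - x) :=
      nonneg_of_mul_nonneg_right (a := γ) (by linarith) hγ
    linarith

end ForwardBackward

/-! ### Assembly of the inner and outer convergence. -/

theorem theorem4p3 {H : Type*} [NormedAddCommGroup H] [InnerProductSpace ℝ H] [CompleteSpace H]
    [FiniteDimensional ℝ H] {m : ℕ} (hm : 1 ≤ m) {G : Fin m → Type*}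
    [∀ i, NormedAddCommGroup (G i)] [∀ i, InnerProductSpace ℝ (G i)] [∀ i, CompleteSpace (G i)]
    (f : H → ℝ) (g : H → EReal) (h : ∀ i, G i → EReal) (B : ∀ i, H →L[ℝ] G i)
    (L : ℝ≥0) (hL : 0 < L)
    (hf_convex : ConvexOn ℝ Set.univ f) (hf_diff : Differentiable ℝ f)
    (hf_lip : LipschitzWith L (gradient f))
    (hg : IsGammaZero g) (hh : ∀ i, IsGammaZero (h i))
    (h_sol : ∃ x, IsSolution f g h B x)
    (γ lam : ℝ) (hγ_pos : 0 < γ) (hγ_lt : γ < 2 / (L : ℝ))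
    (hlam_pos : 0 < lam) (hlam_lt : lam * ∑ i, ‖B i‖ ^ 2 < 2)
    (x₀ : H) (y₀ : ∀ i, G i) (x u : ℕ → H) (y : ℕ → ℕ → ∀ i, G i)
    (hrun : IsNestedDualFB f g h B γ lam x₀ y₀ x u y) :
    -- each inner loop converges to the solution of its subproblem
    (∀ k, IsProx γ (nonsmoothPart g h B) (u k) (prox γ (nonsmoothPart g h B) (u k)) ∧
      Tendsto (fun j => primalPoint g B γ (u k) (y k j)) atTop
        (𝓝 (prox γ (nonsmoothPart g h B) (u k)))) ∧
    -- inner loops carried to convergence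
    ((∀ k, Tendsto (fun j => primalPoint g B γ (u k) (y k j)) atTop (𝓝 (x (k + 1)))) →
      ∃ xs, IsSolution f g h B xs ∧ Tendsto x atTop (𝓝 xs)) ∧
    -- inner loops stopped after finitely many steps, with summable errors
    (∀ J : ℕ → ℕ, (∀ k, x (k + 1) = primalPoint g B γ (u k) (y k (J k + 1))) →
      (Summable fun k => ‖x (k + 1) - prox γ (nonsmoothPart g h B) (u k)‖) →
      ∃ xs, IsSolution f g h B xs ∧ Tendsto x atTop (𝓝 xs)) := by
  have : ProperSpace H := FiniteDimensional.proper_real H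
  obtain ⟨xs, hfin, hmin⟩ := h_sol
  have hxs : nonsmoothPart g h B xs ≠ ⊤ := fun h' => hfin (by rw [h', EReal.coe_add_top])
  have hF := isGammaZero_nonsmoothPart hg hh B ⟨xs, hxs⟩
  have hinner : ∀ k, Tendsto (fun j => primalPoint g B γ (u k) (y k j)) atTop
      (𝓝 (prox γ (nonsmoothPart g h B) (u k))) := fun k =>
    tendsto_primalPoint hg hh hγ_pos hlam_pos hlam_lt ⟨xs, hxs⟩ (hrun.inner_step k)
  have houter : (Summable fun k => ‖x (k + 1) - prox γ (nonsmoothPart g h B) (u k)‖) →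
      ∃ xs, IsSolution f g h B xs ∧ Tendsto x atTop (𝓝 xs) := fun hsum => by
    simp only [hrun.outer] at hsum
    obtain ⟨z, hz, hlim⟩ := exists_tendsto_fixedPoint_of_summable_error
      (lipschitzWith_forwardBackward hL hf_convex hf_diff hf_lip hF hγ_pos hγ_lt)
      (fun z w hz hw =>
        norm_forwardBackward_sub_lt hL hf_convex hf_diff hf_lip hF hγ_pos hγ_lt hz hw)
      ⟨xs, prox_forward_eq_self_of_isMinimizer hf_diff hf_lip hF hγ_pos hxs hmin⟩ hsum
    exact ⟨z, isMinimizer_of_prox_forward_eq_self hf_convex hf_diff hF hγ_pos hz, hlim⟩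
  refine ⟨fun k => ⟨hF.isProx_prox hγ_pos (u k), hinner k⟩, fun hx => houter ?_,
    fun _ _ hsum => houter hsum⟩
  -- Inner loops carried to convergence are the case of zero errors.
  have hzero : ∀ k, ‖x (k + 1) - prox γ (nonsmoothPart g h B) (u k)‖ = 0 := fun k => by
    rw [tendsto_nhds_unique (hx k) (hinner k), sub_self, norm_zero]
  simpa only [hzero] using summable_zero
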